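/- For real $u>0$ let $\zeta(s,u)$ denote the Hurwitz zeta function, i.e. the meromorphic continuation to $s\in\mathbb{C}$ of $\sum_{n=0}^{\infty}(n+u)^{-s}$ ($\operatorname{Re}s>1$), and let the generalised Stieltjes constants $\gamma_p(u)$, $p\ge 0$, be defined by the Laurent expansion about $s=1$ $$\zeta(s,u)=\frac{1}{s-1}+\sum_{p=0}^{\infty}\frac{(-1)^p}{p!}\,\gamma_p(u)\,(s-1)^p .$$ Then $$\gamma_1\left(\tfrac14\right)-\gamma_1\left(\tfrac34\right)=-\pi\left[\gamma+4\log 2+3\log\pi-4\log\Gamma\left(\tfrac14\right)\right],$$ where $\gamma$ is Euler's constant and $\Gamma$ is the gamma function. -/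

import Mathlib

open Filter Topology

/-- The Hurwitz zeta function `ζ(s, u)` for a real parameter `u > 0`: the meromorphic continuation
in `s` of `∑_{n ≥ 0} (n + u)^{-s}`. Mathlib's `HurwitzZeta.hurwitzZeta` is this function for
`0 < u ≤ 1` but is extended periodically in `u`. Writing `u = v + m` with `0 < v ≤ 1` and `m` a
natural number (`m = ⌈u⌉ - 1`), the first `m` terms of the series for `v` are removed.
For `0 < u ≤ 1` one has `m = 0`. -/
noncomputable def hurwitzZetaFun (s : ℂ) (u : ℝ) : ℂ :=
  HurwitzZeta.hurwitzZeta (u : UnitAddCircle) s -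
    ∑ k ∈ Finset.range (⌈u⌉₊ - 1), 1 / ((k : ℂ) + ((u - (⌈u⌉₊ - 1 : ℕ) : ℝ) : ℂ)) ^ s

/-- The regular part `ζ(s, u) - 1 / (s - 1)` of the Hurwitz zeta function at its pole `s = 1`,
with the removable singularity at `s = 1` filled in by the limit. -/
noncomputable def hurwitzZetaRegularPart (u : ℝ) : ℂ → ℂ :=
  Function.update (fun s : ℂ => hurwitzZetaFun s u - 1 / (s - 1)) 1
    (limUnder (𝓝[≠] (1 : ℂ)) fun s : ℂ => hurwitzZetaFun s u - 1 / (s - 1))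

/-- The generalised Stieltjes constant `γ_p(u)`, normalised by the Laurent expansion
`ζ(s, u) = 1 / (s - 1) + ∑_{p ≥ 0} (-1)^p / p! * γ_p(u) * (s - 1)^p` about `s = 1`. -/
noncomputable def stieltjesConstant (p : ℕ) (u : ℝ) : ℂ :=
  (-1) ^ p * iteratedDeriv p (hurwitzZetaRegularPart u) 1

/-- `hurwitzZetaFun` is given by the Hurwitz series for `Re s > 1` and every `u > 0`. -/
theorem hasSum_hurwitzZetaFun {u : ℝ} (hu : 0 < u) {s : ℂ} (hs : 1 < s.re) :
    HasSum (fun n : ℕ => 1 / ((n : ℂ) + (u : ℂ)) ^ s) (hurwitzZetaFun s u) := by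
  have hpos : 0 < ⌈u⌉₊ := Nat.ceil_pos.2 hu
  have h1 : u ≤ (⌈u⌉₊ : ℝ) := Nat.le_ceil u
  have h2 : (⌈u⌉₊ : ℝ) < u + 1 := Nat.ceil_lt_add_one hu.le
  unfold hurwitzZetaFun
  obtain ⟨m, hm⟩ : ∃ m, ⌈u⌉₊ = m + 1 := ⟨⌈u⌉₊ - 1, by omega⟩
  rw [hm] at h1 h2 ⊢
  push_cast at h1 h2
  simp only [Nat.add_sub_cancel]
  have hv : u - (m : ℝ) ∈ Set.Icc (0 : ℝ) 1 := ⟨by linarith, by linarith⟩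
  have hcirc : ((u - (m : ℝ) : ℝ) : UnitAddCircle) = (u : UnitAddCircle) := by
    have hm0 : ((m : ℝ) : UnitAddCircle) = 0 :=
      (AddCircle.coe_eq_zero_iff (1 : ℝ)).2 ⟨m, by simp⟩
    rw [AddCircle.coe_sub, hm0, sub_zero]
  have key := HurwitzZeta.hasSum_hurwitzZeta_of_one_lt_re hv hs
  rw [hcirc, ← hasSum_nat_add_iff' m] at key
  have hf : (fun n : ℕ => 1 / ((n : ℂ) + (u : ℂ)) ^ s) =
      fun n : ℕ => 1 / (((n + m : ℕ) : ℂ) + ((u - (m : ℝ) : ℝ) : ℂ)) ^ s := by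
    funext n
    congr 2
    push_cast
    ring
  rw [hf]
  exact key

/-- The regular part at `s = 1` is entire. -/
theorem differentiable_hurwitzZetaRegularPart {u : ℝ} (hu : 0 < u) :
    Differentiable ℂ (hurwitzZetaRegularPart u) := by
  have hpos : 0 < ⌈u⌉₊ := Nat.ceil_pos.2 hu
  have h2 : (⌈u⌉₊ : ℝ) < u + 1 := Nat.ceil_lt_add_one hu.le
  have hcast : ((⌈u⌉₊ - 1 : ℕ) : ℝ) = (⌈u⌉₊ : ℝ) - 1 := by
    rw [Nat.cast_sub (by omega)]; simp
  have hsum : Differentiable ℂ fun s : ℂ => ∑ k ∈ Finset.range (⌈u⌉₊ - 1),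
      1 / ((k : ℂ) + ((u - (⌈u⌉₊ - 1 : ℕ) : ℝ) : ℂ)) ^ s := by
    refine Differentiable.fun_sum fun k _ => ?_
    have hne : (k : ℂ) + ((u - (⌈u⌉₊ - 1 : ℕ) : ℝ) : ℂ) ≠ 0 := by
      have : (0 : ℝ) < (k : ℝ) + (u - (⌈u⌉₊ - 1 : ℕ)) := by
        rw [hcast]; have : (0 : ℝ) ≤ k := k.cast_nonneg
        linarith
      exact_mod_cast this.ne'
    intro s
    refine (differentiableAt_const _).div (differentiableAt_id.const_cpow (Or.inl hne)) ?_
    exact fun h => hne ((Complex.cpow_eq_zero_iff _ _).1 h).1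
  rw [← differentiableOn_univ]
  refine Complex.differentiableOn_update_limUnder_of_isLittleO univ_mem ?_ ?_
  · intro s hs
    have hs1 : s ≠ 1 := by simpa using hs
    refine DifferentiableAt.differentiableWithinAt ?_
    refine ((HurwitzZeta.differentiableAt_hurwitzZeta _ hs1).sub (hsum s)).sub ?_
    exact (differentiableAt_const _).div (by fun_prop) (sub_ne_zero.2 hs1)
  · have ht : Tendsto (fun s : ℂ => (s - 1) *
        ((hurwitzZetaFun s u - 1 / (s - 1)) - (hurwitzZetaFun 1 u - 1 / (1 - 1))))
        (𝓝[≠] 1) (𝓝 0) := by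
      have hz : Tendsto (fun s : ℂ => s - 1) (𝓝[≠] 1) (𝓝 0) := by
        refine Tendsto.mono_left ?_ nhdsWithin_le_nhds
        exact Continuous.tendsto' (by fun_prop) _ _ (by simp)
      have hr := HurwitzZeta.hurwitzZeta_residue_one (u : UnitAddCircle)
      have hS := (hsum.continuous.tendsto 1).mono_left (nhdsWithin_le_nhds (s := {1}ᶜ))
      have := ((hr.sub (hz.mul hS)).sub_const 1).sub
        (hz.mul_const (hurwitzZetaFun 1 u - 1 / (1 - 1)))
      simp only [zero_mul, sub_zero, sub_self] at this
      refine Tendsto.congr' ?_ this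
      filter_upwards [self_mem_nhdsWithin] with s hs
      have hs1 : s - 1 ≠ 0 := sub_ne_zero.2 hs
      simp only [hurwitzZetaFun]
      field_simp
      ring
    rw [Asymptotics.isLittleO_iff_tendsto' ?_]
    · refine ht.congr fun s => ?_
      rw [div_inv_eq_mul, mul_comm]
    · filter_upwards [self_mem_nhdsWithin] with s hs h
      exact absurd (inv_eq_zero.1 h) (sub_ne_zero.2 hs)

/-- The Laurent expansion about `s = 1` that defines the generalised Stieltjes constants. -/
theorem hasSum_stieltjesConstant {u : ℝ} (hu : 0 < u) {s : ℂ} (hs : s ≠ 1) :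
    HasSum (fun p : ℕ => (-1) ^ p / (p.factorial : ℂ) * stieltjesConstant p u * (s - 1) ^ p)
      (hurwitzZetaFun s u - 1 / (s - 1)) := by
  have h := Complex.hasSum_taylorSeries_of_entire (differentiable_hurwitzZetaRegularPart hu) 1 s
  have h1 : hurwitzZetaRegularPart u s = hurwitzZetaFun s u - 1 / (s - 1) := by
    simp [hurwitzZetaRegularPart, hs]
  rw [h1] at h
  have hf : (fun p : ℕ => (-1) ^ p / (p.factorial : ℂ) * stieltjesConstant p u * (s - 1) ^ p) =
      fun p : ℕ => (p.factorial : ℂ)⁻¹ • (s - 1) ^ p •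
        iteratedDeriv p (hurwitzZetaRegularPart u) 1 := by
    funext p
    have : ((-1 : ℂ) ^ p) * (-1) ^ p = 1 := by rw [← mul_pow]; simp
    simp only [stieltjesConstant, smul_eq_mul]
    linear_combination ((p.factorial : ℂ)⁻¹ * iteratedDeriv p (hurwitzZetaRegularPart u) 1
      * (s - 1) ^ p) * this
  rw [hf]
  exact h

/-! The poles of `ζ(s, 1/4)` and `ζ(s, 3/4)` cancel, so the difference is the entire function `2
H(s)`, with `H` the odd Hurwitz zeta function at `1/4`, and the left side is `-2 H'(1)`. Moreover
`4^(-s) * 2 H(s)` is the Dirichlet beta function `β(s)`. The functional equation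
`hurwitzZetaOdd_one_quarter_one_sub` trades `H'(1)` for `H'(0)`. Near `0`, averaging consecutive
partial sums turns `β` into a series of second differences that converges there
(`four_cpow_mul_hurwitzZetaOdd_eq`). Its termwise derivative at `0` is a logarithmic sum evaluated
by Euler's limit for `log Γ`, and the reflection formula removes `Γ(3/4)`. -/

/-! ### Second differences and convergence of the beta series -/

/-- The real-variable derivative of a complex power. -/
lemma hasDerivAt_ofReal_cpow_of_pos {x : ℝ} (hx : 0 < x) (c : ℂ) :
    HasDerivAt (fun y : ℝ => (y : ℂ) ^ c) (c * (x : ℂ) ^ (c - 1)) x := by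
  have h := ((hasDerivAt_id (x : ℂ)).cpow_const (c := c)
    (Complex.ofReal_mem_slitPlane.2 hx)).comp_ofReal
  simpa using h

/-- Two applications of the mean value inequality: to the first derivative of `y ^ (-s)`, then to
the first difference with step `h`. -/
lemma norm_cpow_second_difference_le {x h : ℝ} (hx : 0 < x) (hh : 0 ≤ h) {s : ℂ}
    (hs : 0 ≤ s.re + 2) :
    ‖(x : ℂ) ^ (-s) - 2 * ((x + h : ℝ) : ℂ) ^ (-s) + ((x + 2 * h : ℝ) : ℂ) ^ (-s)‖ ≤
      ‖s‖ * ‖s + 1‖ * x ^ (-(s.re + 2)) * h ^ 2 := by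
  set C : ℝ := ‖s‖ * ‖s + 1‖ * x ^ (-(s.re + 2)) with hC
  have hd : ∀ y ∈ Set.Ici x,
      HasDerivWithinAt (fun y : ℝ => -s * (y : ℂ) ^ (-s - 1))
        (-s * ((-s - 1) * (y : ℂ) ^ (-s - 1 - 1))) (Set.Ici x) y := fun y hy =>
    ((hasDerivAt_ofReal_cpow_of_pos (hx.trans_le hy) _).const_mul _).hasDerivWithinAt
  have hb : ∀ y ∈ Set.Ici x, ‖-s * ((-s - 1) * (y : ℂ) ^ (-s - 1 - 1))‖ ≤ C := by
    intro y hy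
    have hy0 : 0 < y := hx.trans_le hy
    rw [norm_mul, norm_mul, norm_neg, Complex.norm_cpow_eq_rpow_re_of_pos hy0,
      show -s - 1 = -(s + 1) by ring, norm_neg, ← mul_assoc, hC]
    have : (-(s + 1) - 1).re = -(s.re + 2) := by simp; ring
    rw [this]
    gcongr ?_ * ?_
    exact Real.rpow_le_rpow_of_nonpos hx hy (by linarith)
  have hd2 : ∀ y ∈ Set.Ici x,
      HasDerivWithinAt (fun y : ℝ => ((y + h : ℝ) : ℂ) ^ (-s) - (y : ℂ) ^ (-s))
        (-s * ((y + h : ℝ) : ℂ) ^ (-s - 1) - -s * (y : ℂ) ^ (-s - 1)) (Set.Ici x) y := by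
    intro y hy
    have hy0 : 0 < y := hx.trans_le hy
    exact (((hasDerivAt_ofReal_cpow_of_pos (by linarith : 0 < y + h) _).comp_add_const y h).sub
      (hasDerivAt_ofReal_cpow_of_pos hy0 _)).hasDerivWithinAt
  have hb2 : ∀ y ∈ Set.Ici x,
      ‖-s * ((y + h : ℝ) : ℂ) ^ (-s - 1) - -s * (y : ℂ) ^ (-s - 1)‖ ≤ C * h := by
    intro y hy
    have := (convex_Ici x).norm_image_sub_le_of_norm_hasDerivWithin_le hd hb hy
      (Set.mem_Ici.2 (by linarith [Set.mem_Ici.1 hy]) : y + h ∈ Set.Ici x)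
    simpa [abs_of_nonneg hh] using this
  have := (convex_Ici x).norm_image_sub_le_of_norm_hasDerivWithin_le hd2 hb2
    Set.self_mem_Ici (Set.mem_Ici.2 (by linarith) : x + h ∈ Set.Ici x)
  rw [add_sub_cancel_left, Real.norm_eq_abs, abs_of_nonneg hh] at this
  convert this using 1
  · congr 1
    rw [show x + 2 * h = x + h + h by ring]
    ring
  · ring

/-- The terms of a series for the Dirichlet beta function that converges for `-1 < re s`. -/
noncomputable def betaTerm (n : ℕ) (s : ℂ) : ℂ :=
  (4 * n + 1 : ℂ) ^ (-s) - 2 * (4 * n + 3 : ℂ) ^ (-s) + (4 * n + 5 : ℂ) ^ (-s)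

/-- A radius above `1` puts both `0` and `2` in the ball; one below `2` keeps the decay exponent `re
s + 2` uniformly above `1`. Here `35 = (5/2) * (7/2) * 2 ^ 2`. -/
lemma norm_betaTerm_le (n : ℕ) {s : ℂ} (hs : s ∈ Metric.ball (1 : ℂ) (3 / 2)) :
    ‖betaTerm n s‖ ≤ 35 * ((n : ℝ) + 1) ^ (-(3 / 2) : ℝ) := by
  have hs' : ‖s - 1‖ < 3 / 2 := by simpa [dist_eq_norm] using hs
  have hre : -(1 / 2) < s.re := by
    have := (Complex.abs_re_le_norm (s - 1)).trans_lt hs'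
    rw [abs_lt] at this; simp at this; linarith
  have h1 : ‖s‖ ≤ 5 / 2 := by
    have := norm_add_le (s - 1) 1
    simp at this; linarith
  have h2 : ‖s + 1‖ ≤ 7 / 2 := by
    have := norm_add_le s 1
    simp at this; linarith
  have hx : (1 : ℝ) ≤ 4 * n + 1 := by linarith [n.cast_nonneg (α := ℝ)]
  have key := norm_cpow_second_difference_le (x := 4 * n + 1) (h := 2) (by linarith) (by norm_num)
    (s := s) (by linarith)
  rw [show (4 * n + 1 + 2 : ℝ) = 4 * n + 3 by ring,
    show (4 * n + 1 + 2 * 2 : ℝ) = 4 * n + 5 by ring] at key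
  push_cast at key
  have h3 : (4 * n + 1 : ℝ) ^ (-(s.re + 2)) ≤ ((n : ℝ) + 1) ^ (-(3 / 2) : ℝ) :=
    (Real.rpow_le_rpow_of_exponent_le hx (by linarith)).trans
      (Real.rpow_le_rpow_of_nonpos (by positivity) (by linarith [n.cast_nonneg (α := ℝ)])
        (by norm_num))
  calc ‖betaTerm n s‖ ≤ _ := key
    _ ≤ (5 / 2) * (7 / 2) * ((n : ℝ) + 1) ^ (-(3 / 2) : ℝ) * 2 ^ 2 := by gcongr
    _ = _ := by ring

lemma summable_betaTerm_bound :
    Summable fun n : ℕ => 35 * ((n : ℝ) + 1) ^ (-(3 / 2) : ℝ) := by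
  refine Summable.mul_left _ ?_
  have := (summable_nat_add_iff 1).2 (Real.summable_nat_rpow.2 (by norm_num : (-(3 / 2) : ℝ) < -1))
  simpa using this

lemma hasDerivAt_betaTerm (n : ℕ) (s : ℂ) :
    HasDerivAt (betaTerm n) (-(Complex.log (4 * n + 1) * (4 * n + 1 : ℂ) ^ (-s)) +
      2 * (Complex.log (4 * n + 3) * (4 * n + 3 : ℂ) ^ (-s)) -
      Complex.log (4 * n + 5) * (4 * n + 5 : ℂ) ^ (-s)) s := by
  have h : ∀ c : ℂ, c ≠ 0 → HasDerivAt (fun s => c ^ (-s)) (c ^ (-s) * Complex.log c * -1) s :=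
    fun c hc => (hasDerivAt_neg s).const_cpow (Or.inl hc)
  have h1 : (4 * n + 1 : ℂ) ≠ 0 := by exact_mod_cast (4 * n).succ_ne_zero
  have h3 : (4 * n + 3 : ℂ) ≠ 0 := by exact_mod_cast (4 * n + 2).succ_ne_zero
  have h5 : (4 * n + 5 : ℂ) ≠ 0 := by exact_mod_cast (4 * n + 4).succ_ne_zero
  refine (((h _ h1).sub ((h _ h3).const_mul 2)).add (h _ h5)).congr_deriv ?_
  ring

lemma differentiable_betaTerm (n : ℕ) : Differentiable ℂ (betaTerm n) :=
  fun s => (hasDerivAt_betaTerm n s).differentiableAt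

/-! ### Identification with the odd Hurwitz zeta function -/

lemma hasSum_four_mul_add_cpow_neg {a : ℝ} (ha : a ∈ Set.Icc 0 1) {s : ℂ} (hs : 1 < s.re) :
    HasSum (fun n : ℕ => (4 * n + 4 * a : ℂ) ^ (-s))
      (4 ^ (-s) * HurwitzZeta.hurwitzZeta (a : UnitAddCircle) s) := by
  have h := (HurwitzZeta.hasSum_hurwitzZeta_of_one_lt_re ha hs).mul_left (4 ^ (-s))
  refine h.congr_fun fun n => ?_
  have := Complex.mul_cpow_ofReal_nonneg (a := 4) (b := n + a) (by norm_num)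
    (add_nonneg n.cast_nonneg ha.1) (-s)
  push_cast at this
  rw [one_div, ← Complex.cpow_neg, ← this, mul_add]

lemma hasSum_four_mul_add_one_cpow_neg {s : ℂ} (hs : 1 < s.re) :
    HasSum (fun n : ℕ => (4 * n + 1 : ℂ) ^ (-s))
      (4 ^ (-s) * HurwitzZeta.hurwitzZeta ((1 / 4 : ℝ) : UnitAddCircle) s) := by
  refine (hasSum_four_mul_add_cpow_neg (by norm_num) hs).congr_fun fun n => ?_
  push_cast
  ring_nf

lemma hasSum_four_mul_add_three_cpow_neg {s : ℂ} (hs : 1 < s.re) :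
    HasSum (fun n : ℕ => (4 * n + 3 : ℂ) ^ (-s))
      (4 ^ (-s) * HurwitzZeta.hurwitzZeta ((3 / 4 : ℝ) : UnitAddCircle) s) := by
  refine (hasSum_four_mul_add_cpow_neg (by norm_num) hs).congr_fun fun n => ?_
  push_cast
  ring_nf

lemma coe_three_quarters : ((3 / 4 : ℝ) : UnitAddCircle) = -((1 / 4 : ℝ) : UnitAddCircle) := by
  rw [← AddCircle.coe_neg, ← sub_eq_zero, ← AddCircle.coe_sub, AddCircle.coe_eq_zero_iff]
  exact ⟨1, by norm_num⟩

lemma hurwitzZeta_one_quarter_sub (s : ℂ) :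
    HurwitzZeta.hurwitzZeta ((1 / 4 : ℝ) : UnitAddCircle) s -
      HurwitzZeta.hurwitzZeta ((3 / 4 : ℝ) : UnitAddCircle) s =
      2 * HurwitzZeta.hurwitzZetaOdd ((1 / 4 : ℝ) : UnitAddCircle) s := by
  rw [coe_three_quarters, HurwitzZeta.hurwitzZetaOdd_eq]
  ring

lemma analyticOnNhd_four_cpow_mul_hurwitzZetaOdd (U : Set ℂ) :
    AnalyticOnNhd ℂ (fun s : ℂ => 4 ^ (-s) *
      (2 * HurwitzZeta.hurwitzZetaOdd ((1 / 4 : ℝ) : UnitAddCircle) s)) U := by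
  have h : Differentiable ℂ (fun s : ℂ => 4 ^ (-s) *
      (2 * HurwitzZeta.hurwitzZetaOdd ((1 / 4 : ℝ) : UnitAddCircle) s)) := by
    refine Differentiable.mul ?_ ((HurwitzZeta.differentiable_hurwitzZetaOdd _).const_mul 2)
    exact differentiable_id.neg.const_cpow (Or.inl (by norm_num))
  exact fun s _ => h.analyticAt s

lemma eventually_one_lt_re_nhds_two : ∀ᶠ s : ℂ in 𝓝 2, 1 < s.re :=
  (isOpen_lt continuous_const Complex.continuous_re).mem_nhds (by simp)

/-- By the identity theorem it suffices to compare near `2`, where the Dirichlet series converge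
absolutely. -/
lemma four_cpow_mul_hurwitzZetaOdd_eq {s : ℂ} (hs : s ∈ Metric.ball (1 : ℂ) (3 / 2)) :
    4 ^ (-s) * (2 * HurwitzZeta.hurwitzZetaOdd ((1 / 4 : ℝ) : UnitAddCircle) s) =
      1 / 2 + 1 / 2 * ∑' n, betaTerm n s := by
  have hA : AnalyticOnNhd ℂ (fun s => 1 / 2 + 1 / 2 * ∑' n, betaTerm n s)
      (Metric.ball (1 : ℂ) (3 / 2)) := by
    refine DifferentiableOn.analyticOnNhd ?_ Metric.isOpen_ball
    refine ((Complex.differentiableOn_tsum_of_summable_norm summable_betaTerm_bound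
      (fun n => (differentiable_betaTerm n).differentiableOn) Metric.isOpen_ball
      fun n s hs => norm_betaTerm_le n hs).const_mul _).const_add _
  refine (analyticOnNhd_four_cpow_mul_hurwitzZetaOdd _).eqOn_of_preconnected_of_eventuallyEq hA
    (convex_ball _ _).isPreconnected (z₀ := 2) ?_ ?_ hs
  · rw [Metric.mem_ball, dist_eq_norm]; norm_num
  · filter_upwards [eventually_one_lt_re_nhds_two] with s hs
    have h1 := hasSum_four_mul_add_one_cpow_neg hs
    have h3 := hasSum_four_mul_add_three_cpow_neg hs
    -- The `4n + 5` series is the `4n + 1` series without its first term `1`; hence `∑ betaTerm = 2β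
    -- - 1`.
    have h5 := (hasSum_nat_add_iff' 1).2 h1
    rw [← hurwitzZeta_one_quarter_sub]
    have h := ((h1.sub (h3.mul_left 2)).add h5).congr_fun (g := fun n => betaTerm n s) fun n => by
      simp only [betaTerm]
      push_cast
      ring_nf
    rw [h.tsum_eq]
    simp
    ring

/-- The coefficients `sin (π n / 2)` are `0, 1, 0, -1` modulo `4`. This makes the functional
equation of `H` relate `H` to itself. -/
lemma sinZeta_one_quarter (s : ℂ) :
    HurwitzZeta.sinZeta ((1 / 4 : ℝ) : UnitAddCircle) s =
      4 ^ (-s) * (2 * HurwitzZeta.hurwitzZetaOdd ((1 / 4 : ℝ) : UnitAddCircle) s) := by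
  refine congrFun (AnalyticOnNhd.eq_of_eventuallyEq (z₀ := 2) (fun s _ =>
    (HurwitzZeta.differentiableAt_sinZeta _).analyticAt s)
    (analyticOnNhd_four_cpow_mul_hurwitzZetaOdd _) ?_) s
  filter_upwards [eventually_one_lt_re_nhds_two] with s hs
  have h := HurwitzZeta.hasSum_nat_sinZeta (1 / 4) hs
  have h1 := hasSum_four_mul_add_one_cpow_neg hs
  have h3 := hasSum_four_mul_add_three_cpow_neg hs
  have e (j m : ℕ) : Real.sin (2 * Real.pi * (1 / 4) * ((j + 4 * m : ℕ) : ℝ)) =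
      Real.sin (j * (Real.pi / 2)) := by
    rw [← Real.sin_add_nat_mul_two_pi (j * (Real.pi / 2)) m]
    congr 1
    push_cast
    ring
  rw [← h.tsum_eq, Nat.sumByResidueClasses h.summable 4, ← hurwitzZeta_one_quarter_sub]
  -- `ZMod 4` is `Fin 4` by definition.
  change ∑ j : Fin 4, _ = _
  have v0 : (0 : ZMod 4).val = 0 := rfl
  have v1 : (1 : ZMod 4).val = 1 := rfl
  have v2 : (2 : ZMod 4).val = 2 := rfl
  have v3 : (3 : ZMod 4).val = 3 := rfl
  have s3 : Real.sin (3 * (Real.pi / 2)) = -1 := by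
    rw [show 3 * (Real.pi / 2) = Real.pi / 2 + Real.pi by ring, Real.sin_add_pi]; simp
  have s2 : Real.sin (2 * (Real.pi / 2)) = 0 := by
    rw [show 2 * (Real.pi / 2) = Real.pi by ring, Real.sin_pi]
  rw [Fin.sum_univ_four]
  erw [v0, v1, v2, v3]
  simp only [e]
  have t1 : ∑' m : ℕ, ((Real.sin ((1 : ℕ) * (Real.pi / 2)) : ℝ) : ℂ) / ((1 + 4 * m : ℕ) : ℂ) ^ s =
      4 ^ (-s) * HurwitzZeta.hurwitzZeta ((1 / 4 : ℝ) : UnitAddCircle) s := by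
    rw [← h1.tsum_eq]
    congr 1; ext m
    simp [Complex.cpow_neg, add_comm]
  have t3 : ∑' m : ℕ, ((Real.sin ((3 : ℕ) * (Real.pi / 2)) : ℝ) : ℂ) / ((3 + 4 * m : ℕ) : ℂ) ^ s =
      -(4 ^ (-s) * HurwitzZeta.hurwitzZeta ((3 / 4 : ℝ) : UnitAddCircle) s) := by
    rw [← h3.tsum_eq, ← tsum_neg]
    congr 1; ext m
    simp [Complex.cpow_neg, add_comm, s3, neg_div]
  rw [t1, t3]
  simp [s2]
  ring

local notation "H" => HurwitzZeta.hurwitzZetaOdd ((1 / 4 : ℝ) : UnitAddCircle)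

/-! ### Value and derivative at `0` -/

open Real.BohrMollerup in
lemma tendsto_sum_log_second_difference :
    Tendsto (fun N : ℕ => ∑ n ∈ Finset.range (N + 1),
      (-Real.log (4 * n + 1) + 2 * Real.log (4 * n + 3) - Real.log (4 * n + 5))) atTop
      (𝓝 (2 * Real.log (Real.Gamma (1 / 4)) - 2 * Real.log (Real.Gamma (3 / 4)) - Real.log 4)) := by
  have h1 := tendsto_log_gamma (x := 1 / 4) (by norm_num)
  have h3 := tendsto_log_gamma (x := 3 / 4) (by norm_num)
  -- Twice the difference of the `logGammaSeq` contributes `-log N`, while the telescoping part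
  -- contributes `-log (N + 5/4)`; `hl` accounts for the discrepancy.
  have hl : Tendsto (fun n : ℕ => Real.log ((n : ℝ) + 5 / 4) - Real.log n) atTop (𝓝 0) :=
    (Real.tendsto_log_comp_add_sub_log (5 / 4)).comp tendsto_natCast_atTop_atTop
  have := (((h1.const_mul 2).sub (h3.const_mul 2)).sub_const (Real.log 4)).sub hl
  rw [sub_zero] at this
  refine this.congr fun N => ?_
  have hlog (n : ℕ) (c : ℝ) (hc : 0 < c) :
      Real.log (4 * n + 4 * c) = Real.log 4 + Real.log (c + n) := by
    rw [← Real.log_mul (by norm_num) (by positivity)]; congr 1; ring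
  have htel : ∑ n ∈ Finset.range (N + 1), (Real.log (5 / 4 + n) - Real.log (1 / 4 + n)) =
      Real.log (5 / 4 + N) + Real.log 4 := by
    have := Finset.sum_range_sub (fun n : ℕ => Real.log (1 / 4 + n)) (N + 1)
    rw [show Real.log 4 = - Real.log (1 / 4) by rw [one_div, Real.log_inv]; ring]
    convert this using 1
    · refine Finset.sum_congr rfl fun n _ => ?_
      push_cast; ring_nf
    · push_cast; ring_nf
  have hterm (n : ℕ) : -Real.log (4 * n + 1) + 2 * Real.log (4 * n + 3) - Real.log (4 * n + 5) =
      2 * Real.log (3 / 4 + n) - 2 * Real.log (1 / 4 + n) -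
        (Real.log (5 / 4 + n) - Real.log (1 / 4 + n)) := by
    have e1 := hlog n (1 / 4) (by norm_num)
    have e3 := hlog n (3 / 4) (by norm_num)
    have e5 := hlog n (5 / 4) (by norm_num)
    norm_num at e1 e3 e5 ⊢
    linarith
  simp_rw [hterm]
  rw [Finset.sum_sub_distrib, Finset.sum_sub_distrib, htel, ← Finset.mul_sum, ← Finset.mul_sum,
    logGammaSeq, logGammaSeq, add_comm (N : ℝ)]
  ring

lemma hasDerivAt_hurwitzZetaOdd (s : ℂ) : HasDerivAt H (deriv H s) s :=
  (HurwitzZeta.differentiable_hurwitzZetaOdd _ s).hasDerivAt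

lemma zero_mem_ball_one : (0 : ℂ) ∈ Metric.ball (1 : ℂ) (3 / 2) := by
  rw [Metric.mem_ball, dist_eq_norm]; norm_num

lemma hurwitzZetaOdd_one_quarter_zero : H 0 = 1 / 4 := by
  have h := four_cpow_mul_hurwitzZetaOdd_eq zero_mem_ball_one
  -- At `s = 0` each second difference is `1 - 2 + 1`.
  have h0 (n : ℕ) : betaTerm n 0 = 0 := by simp [betaTerm]; norm_num
  simp only [h0, tsum_zero, neg_zero, Complex.cpow_zero] at h
  linear_combination h / 2

lemma hasDerivAt_four_cpow_mul (s : ℂ) :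
    HasDerivAt (fun s : ℂ => 4 ^ (-s) * (2 * H s))
      (4 ^ (-s) * (2 * deriv H s) - 4 ^ (-s) * Real.log 4 * (2 * H s)) s := by
  have h := ((hasDerivAt_neg s).const_cpow (c := 4) (Or.inl (by norm_num))).mul
    ((hasDerivAt_hurwitzZetaOdd s).const_mul 2)
  refine h.congr_deriv ?_
  rw [Complex.ofReal_log (by norm_num)]
  push_cast
  ring

lemma deriv_hurwitzZetaOdd_one_quarter_zero :
    2 * deriv H 0 = ((Real.log (Real.Gamma (1 / 4)) - Real.log (Real.Gamma (3 / 4)) : ℝ) : ℂ) := by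
  have hs := Complex.hasSum_deriv_of_summable_norm summable_betaTerm_bound
      (fun n => (differentiable_betaTerm n).differentiableOn) Metric.isOpen_ball
      (fun n s hs => norm_betaTerm_le n hs) zero_mem_ball_one
  -- The shift matches `logGammaSeq`, whose sum runs over `range (N + 1)`.
  have ht := (hs.tendsto_sum_nat).comp (tendsto_add_atTop_nat 1)
  have ht' := (Complex.continuous_ofReal.tendsto _).comp tendsto_sum_log_second_difference
  have heq : deriv (fun s => ∑' n, betaTerm n s) 0 =
      ((2 * Real.log (Real.Gamma (1 / 4)) - 2 * Real.log (Real.Gamma (3 / 4)) - Real.log 4 : ℝ) :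
        ℂ) := by
    refine tendsto_nhds_unique ht (ht'.congr fun N => ?_)
    simp only [Function.comp_apply, Complex.ofReal_sum]
    refine Finset.sum_congr rfl fun n _ => ?_
    rw [(hasDerivAt_betaTerm n 0).deriv]
    push_cast
    rw [Complex.ofReal_log (by positivity), Complex.ofReal_log (by positivity),
      Complex.ofReal_log (by positivity)]
    push_cast
    simp
  have hd : DifferentiableAt ℂ (fun s => ∑' n, betaTerm n s) 0 :=
    (Complex.differentiableOn_tsum_of_summable_norm summable_betaTerm_bound
      (fun n => (differentiable_betaTerm n).differentiableOn) Metric.isOpen_ball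
      fun n s hs => norm_betaTerm_le n hs).differentiableAt
      (Metric.isOpen_ball.mem_nhds zero_mem_ball_one)
  have h1 := (hd.hasDerivAt.const_mul (1 / 2)).const_add (1 / 2)
  have h2 := (hasDerivAt_four_cpow_mul 0).congr_of_eventuallyEq
    (f₁ := fun s => 1 / 2 + 1 / 2 * ∑' n, betaTerm n s) <| by
      filter_upwards [Metric.isOpen_ball.mem_nhds zero_mem_ball_one] with s hs
      exact (four_cpow_mul_hurwitzZetaOdd_eq hs).symm
  have h := h1.unique h2
  rw [heq, hurwitzZetaOdd_one_quarter_zero, neg_zero, Complex.cpow_zero] at h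
  push_cast at h ⊢
  linear_combination -h

/-! ### Reflection, functional equation and derivative at `1` -/

lemma log_Gamma_three_quarters : Real.log (Real.Gamma (3 / 4)) =
    Real.log Real.pi + Real.log 2 / 2 - Real.log (Real.Gamma (1 / 4)) := by
  have h := Real.Gamma_mul_Gamma_one_sub (1 / 4)
  rw [show (1 - 1 / 4 : ℝ) = 3 / 4 by norm_num, show Real.pi * (1 / 4) = Real.pi / 4 by ring,
    Real.sin_pi_div_four] at h
  have h1 : Real.Gamma (1 / 4) ≠ 0 := (Real.Gamma_pos_of_pos (by norm_num)).ne'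
  have h3 : Real.Gamma (3 / 4) ≠ 0 := (Real.Gamma_pos_of_pos (by norm_num)).ne'
  have h2 : (√2 : ℝ) ≠ 0 := by positivity
  apply_fun Real.log at h
  rw [Real.log_mul h1 h3, Real.log_div Real.pi_ne_zero (by positivity),
    Real.log_div h2 (by norm_num), Real.log_sqrt (by norm_num)] at h
  linarith

/-- The functional equation of the Dirichlet beta function. -/
lemma hurwitzZetaOdd_one_quarter_one_sub {s : ℂ} (hs : 0 < s.re) :
    H (1 - s) = 2 * ((2 * Real.pi) ^ (-s) * Complex.Gamma s * Complex.sin (Real.pi * s / 2) *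
      (4 ^ (-s) * (2 * H s))) := by
  have h : ∀ n : ℕ, s ≠ -n := by
    rintro n rfl
    simp at hs
    linarith [n.cast_nonneg (α := ℝ)]
  rw [HurwitzZeta.hurwitzZetaOdd_one_sub _ h, sinZeta_one_quarter]
  ring

lemma hurwitzZetaOdd_one_quarter_one : H 1 = Real.pi / 2 := by
  have h := hurwitzZetaOdd_one_quarter_one_sub (s := 1) (by simp)
  have hpi : (Real.pi : ℂ) ≠ 0 := by exact_mod_cast Real.pi_ne_zero
  rw [sub_self, hurwitzZetaOdd_one_quarter_zero, Complex.Gamma_one, mul_one, mul_one, Complex.sin_pi_div_two,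
    Complex.cpow_neg_one, Complex.cpow_neg_one] at h
  field_simp at h
  field_simp
  linear_combination -h

/-- Differentiate the functional equation at `s = 1`: `Γ'(1) = -γ`, and the sine factor contributes
nothing because `cos (π / 2) = 0`. -/
lemma deriv_hurwitzZetaOdd_one_quarter_one :
    deriv H 1 = Real.pi / 2 * (Real.eulerMascheroniConstant + Real.log (2 * Real.pi) + Real.log 4)
      - 2 * Real.pi * deriv H 0 := by
  have hpi : (Real.pi : ℂ) ≠ 0 := by exact_mod_cast Real.pi_ne_zero
  have hl : HasDerivAt (fun s : ℂ => H (1 - s)) (deriv H 0 * (-1)) 1 := by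
    have := hasDerivAt_hurwitzZetaOdd (1 - 1)
    rw [sub_self] at this
    exact HasDerivAt.comp (h₂ := H) (h := fun s => 1 - s) 1 (by simpa using this)
      ((hasDerivAt_id 1).const_sub 1)
  have hc : HasDerivAt (fun s : ℂ => (2 * Real.pi : ℂ) ^ (-s))
      ((2 * Real.pi : ℂ) ^ (-1 : ℂ) * Complex.log (2 * Real.pi) * -1) 1 :=
    (hasDerivAt_neg 1).const_cpow (Or.inl (by simp [hpi]))
  have hsin : HasDerivAt (fun s : ℂ => Complex.sin (Real.pi * s / 2))
      (Complex.cos (Real.pi * 1 / 2) * (Real.pi * 1 / 2)) 1 :=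
    (((hasDerivAt_id (1 : ℂ)).const_mul (Real.pi : ℂ)).div_const 2).csin
  have hr := (((hc.mul Complex.hasDerivAt_Gamma_one).mul hsin).mul
    (hasDerivAt_four_cpow_mul 1)).const_mul 2
  have h := hl.unique <| hr.congr_of_eventuallyEq <| by
    filter_upwards [(isOpen_lt continuous_const Complex.continuous_re).mem_nhds
      (by simp : (0 : ℝ) < (1 : ℂ).re)] with s hs
    exact hurwitzZetaOdd_one_quarter_one_sub hs
  rw [Complex.ofReal_log (by positivity)]
  simp only [Pi.mul_apply, mul_one, Complex.cos_pi_div_two, Complex.sin_pi_div_two,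
    Complex.Gamma_one, Complex.cpow_neg_one, hurwitzZetaOdd_one_quarter_one] at h
  push_cast
  field_simp at h ⊢
  linear_combination -h / 2

/-! ### Return to the Stieltjes constants -/

lemma hurwitzZetaFun_of_le_one {u : ℝ} (hu : u ≤ 1) (s : ℂ) :
    hurwitzZetaFun s u = HurwitzZeta.hurwitzZeta (u : UnitAddCircle) s := by
  have : ⌈u⌉₊ - 1 = 0 := Nat.sub_eq_zero_of_le (Nat.ceil_le.2 (by simpa using hu))
  simp [hurwitzZetaFun, this]

/-- Off `s = 1` the terms `1 / (s - 1)` cancel; continuity covers `s = 1`, so the filled-in limits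
need no evaluation. -/
lemma hurwitzZetaRegularPart_one_quarter_sub :
    hurwitzZetaRegularPart (1 / 4) - hurwitzZetaRegularPart (3 / 4) = fun s => 2 * H s := by
  have h1 := differentiable_hurwitzZetaRegularPart (u := 1 / 4) (by norm_num)
  have h3 := differentiable_hurwitzZetaRegularPart (u := 3 / 4) (by norm_num)
  refine Continuous.ext_on (s := {1}ᶜ) (dense_compl_singleton 1) (h1.continuous.sub h3.continuous)
    ((HurwitzZeta.differentiable_hurwitzZetaOdd _).continuous.const_mul 2) fun s hs => ?_
  have hs1 : s ≠ 1 := hs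
  rw [← hurwitzZeta_one_quarter_sub]
  simp only [Pi.sub_apply, hurwitzZetaRegularPart, Function.update_of_ne hs1]
  rw [hurwitzZetaFun_of_le_one (by norm_num), hurwitzZetaFun_of_le_one (by norm_num)]
  ring

theorem mainTheorem1 :
    stieltjesConstant 1 (1 / 4) - stieltjesConstant 1 (3 / 4) =
      ((-Real.pi * (Real.eulerMascheroniConstant + 4 * Real.log 2 + 3 * Real.log Real.pi -
        4 * Real.log (Real.Gamma (1 / 4))) : ℝ) : ℂ) := by
  have h1 := differentiable_hurwitzZetaRegularPart (u := 1 / 4) (by norm_num)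
  have h3 := differentiable_hurwitzZetaRegularPart (u := 3 / 4) (by norm_num)
  have hd := deriv_sub (h1 1) (h3 1)
  rw [hurwitzZetaRegularPart_one_quarter_sub,
    ((hasDerivAt_hurwitzZetaOdd 1).const_mul 2).deriv,
    deriv_hurwitzZetaOdd_one_quarter_one] at hd
  have h0 := deriv_hurwitzZetaOdd_one_quarter_zero
  rw [log_Gamma_three_quarters] at h0
  have l4 : Real.log 4 = 2 * Real.log 2 := by
    rw [show (4 : ℝ) = 2 ^ 2 by norm_num, Real.log_pow]; norm_num
  rw [Real.log_mul (by norm_num) Real.pi_ne_zero, l4] at hd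
  simp only [stieltjesConstant, iteratedDeriv_one]
  push_cast at hd h0 ⊢
  linear_combination hd + 2 * Real.pi * h0
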